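/- **Setting.** Fix $n_a,n_b,n_y,n_u,M\in\mathbb N$. A NARX state is $x_k=(y_k,\dots,y_{k-n_a},u_{k-1},\dots,u_{k-n_b})$ with $y_i\in\mathbb R^{n_y}$, $u_i\in\mathbb R^{n_u}$, normed by the Euclidean norm. The learned predictor is the posterior predictive mean $f(x,u)=\sum_{m=1}^M\varphi_m(x,u)\,\mu_m$, where the $\varphi_m$ are real-valued basis functions and $\mu_m\in\mathbb R^{n_y}$ are the posterior means of the weights. The nominal model is $F(x_k,u_k)=(f(x_k,u_k),y_k,\dots,y_{k-n_a+1},u_k,\dots,u_{k-n_b+1})$. Let $\mathcal Y\subseteq\mathbb R^{n_y}$, $\mathcal U\subseteq\mathbb R^{n_u}$, $\mathcal X=\mathcal Y^{n_a+1}\times\mathcal U^{n_b}$, let $y_r$ be an interior point of $\mathcal Y$, $u_r\in\mathcal U$, $x_r=(y_r,\dots,y_r,u_r,\dots,u_r)$, and $F(x_r,u_r)=x_r$. The stage cost is $\ell(x,u)=\ell_s(x-x_r,u-u_r)+\ell_b(y)$, with $y$ the current output of $x$, where $\ell_b=0$ on $\mathcal Y$ and $\ell_b(y)\ge\alpha_b(\operatorname{dist}(y,\mathcal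 Y))$ for some class-$\mathcal K$ function $\alpha_b$. A terminal law $\kappa_f$, a terminal cost $V_f$, a weight $\lambda\ge1$ and horizons $1\le N_c\le N_p$ are given. At a state $x$, the NSVB-MPC problem is to minimize over $u_0,\dots,u_{N_c-1}$ $$J(x,u)=\sum_{i=0}^{N_c-1}\ell(\hat x_i,u_i)+\sum_{i=N_c}^{N_p-1}\ell(\hat x_i,\kappa_f(\hat x_i))+\lambda V_f(\hat x_{N_p}-x_r)$$ subject to $\hat x_0=x$, $\hat x_{j+1}=F(\hat x_j,u_j)$ for $j=0,\dots,N_p-1$ (with $u_j=\kappa_f(\hat x_j)$ for $j\ge N_c$), and $\hat x_j\in\mathcal X$, $u_j\in\mathcal U$ for $j=0,\dots,N_p-1$; there is no terminal constraint. Let $V^*(x)$ be the optimal (infimal) cost. **Assumptions.** 1. $\ell$ is continuous, $\ell(x_r,u_r)=0$, and for all $x\in\mathcal X$, $u\in\mathcal U$: $\ell(x,u)\ge\alpha_x(\|x-x_r\|)+\alpha_u(\|u-u_r\|)$ and $\ell(x,u)\ge\alpha_y(\|x-x_r\|)$, with $\alpha_x,\alpha_u,\alpha_y$ of class $\mathcal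 K$. 2. For some $\vartheta>0$, the region $\Omega_\vartheta=\{x:V_f(x-x_r)\le\vartheta\}$ contains $x_r$ in its interior, and there are class-$\mathcal K_\infty$ functions $\alpha_1,\alpha_2$ such that for all $x\in\Omega_\vartheta$: $\alpha_1(\|x-x_r\|)\le V_f(x-x_r)\le\alpha_2(\|x-x_r\|)$, $V_f(F(x,\kappa_f(x))-x_r)-V_f(x-x_r)\le-\ell_s(x-x_r,\kappa_f(x)-u_r)$, and $\kappa_f(x)\in\mathcal U$. 3. Let $d>0$ be such that $\ell(x,u)\ge d$ for all $x\in\mathcal X\setminus\Omega_\vartheta$, $u\in\mathcal U$, and let $\mathcal X_{N_c,N_p}(\lambda)$ be the set of states $x$ at which the problem is feasible and $V^*(x)\le N_p d+\lambda\vartheta$. On $\mathcal X_{N_c,N_p}(\lambda)$, $F(\cdot,u)$ and $\ell(\cdot,u)$ are uniformly continuous, uniformly in $u\in\mathcal U$, and $x\mapsto V_f(x-x_r)$ is uniformly continuous. If $N_c<N_p$, then also $x\mapsto F(x,\kappa_f(x))$ and $x\mapsto\ell(x,\kappa_f(x))$ are uniformly continuous on $\mathcal X_{N_c,N_p}(\lambda)\cap\Omega_\vartheta$.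 4. $\kappa$ is a predictive controller: for each $x\in\mathcal X_{N_c,N_p}(\lambda)$ the minimum is attained and $\kappa(x)$ is the first input $u_0$ of a minimizer. The true closed loop is $x_{k+1}=(f(x_k,\kappa(x_k))+\delta_k,\,y_k,\dots,y_{k-n_a+1},\,\kappa(x_k),u_{k-1},\dots,u_{k-n_b+1})$, where $\delta_k=y_{k+1}-\hat y_{k+1}$ is the prediction error. **Theorem.** There is $\bar\nu>0$ such that for every $\nu\in[0,\bar\nu]$ there is a set $\Omega_\delta\subseteq\mathcal X_{N_c,N_p}(\lambda)$, containing a neighbourhood of $x_r$ relative to $\mathcal X$, such that * $\Omega_\delta$ is robustly invariant: for every $x_k\in\Omega_\delta$ and every $\delta_k$ with $\|\delta_k\|\le\nu$, the successor $x_{k+1}$ lies in $\Omega_\delta$; * the closed loop is input-to-state stable in $\Omega_\delta$ with respect to the prediction error: there are a class-$\mathcal{KL}$ function $\beta$ and a class-$\mathcal K$ function $\gamma$ such that for all $x_0\in\Omega_\delta$, all error sequences with $\|\delta_k\|\le\nu$ for every $k$, and all $k\ge0$, $$\|x_k-x_r\|\le\beta(\|x_0-x_r\|,k)+\gamma\Big(\sup_{i\ge0}\|\delta_i\|\Big).$$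 -/

import Mathlib

open Filter Topology

noncomputable section

/-- Class `𝒦`: continuous and strictly increasing on `[0, ∞)`, vanishing at `0`. -/
def IsClassK (α : ℝ → ℝ) : Prop :=
  ContinuousOn α (Set.Ici 0) ∧ StrictMonoOn α (Set.Ici 0) ∧ α 0 = 0

/-- Class `𝒦∞`: class `𝒦` and unbounded. -/
def IsClassKInfty (α : ℝ → ℝ) : Prop :=
  IsClassK α ∧ Tendsto α atTop atTop

/-- Class `𝒦ℒ` in discrete time: class `𝒦` in the first argument, decreasing to `0` in the
second one. -/
def IsClassKL (β : ℝ → ℕ → ℝ) : Prop :=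
  (∀ k, IsClassK (fun s => β s k)) ∧
    ∀ s, 0 ≤ s → Antitone (β s) ∧ Tendsto (β s) atTop (𝓝 0)

/-- Outputs `y ∈ ℝ^{n_y}`. -/
abbrev Out (ny : ℕ) : Type := EuclideanSpace ℝ (Fin ny)

/-- Inputs `u ∈ ℝ^{n_u}`. -/
abbrev Inp (nu : ℕ) : Type := EuclideanSpace ℝ (Fin nu)

/-- NARX states `(y_k, …, y_{k-n_a}, u_{k-1}, …, u_{k-n_b})`, with the Euclidean norm of the
concatenated vector. -/
abbrev NState (na nb ny nu : ℕ) : Type :=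
  EuclideanSpace ℝ ((Fin (na + 1) × Fin ny) ⊕ (Fin nb × Fin nu))

namespace NState

variable {na nb ny nu : ℕ}

/-- The stored output `y_{k-i}`. -/
def out (x : NState na nb ny nu) (i : Fin (na + 1)) : Out ny :=
  WithLp.toLp 2 (fun c => x (Sum.inl (i, c)))

/-- The stored input `u_{k-1-j}`. -/
def inp (x : NState na nb ny nu) (j : Fin nb) : Inp nu :=
  WithLp.toLp 2 (fun c => x (Sum.inr (j, c)))

/-- The state with given stored outputs and inputs. -/
def mk (y : Fin (na + 1) → Out ny) (u : Fin nb → Inp nu) : NState na nb ny nu :=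
  WithLp.toLp 2 (Sum.elim (fun p => y p.1 p.2) (fun p => u p.1 p.2))

/-- The next state when the new output is `y` and the input applied was `u`: both are put in
front, and the oldest output and input are dropped. -/
def push (x : NState na nb ny nu) (y : Out ny) (u : Inp nu) : NState na nb ny nu :=
  mk (fun i => Fin.cons (α := fun _ => Out ny) y x.out i.castSucc)
    (fun j => Fin.cons (α := fun _ => Inp nu) u x.inp j.castSucc)

end NState

/-- The data of a model predictive control problem built on a learned NARX model (no property
is assumed here). -/
structure NSVBMPC (na nb ny nu M : ℕ) where
  /-- the dictionary of basis functions `φ_m(x, u)` -/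
  φ : Fin M → NState na nb ny nu → Inp nu → ℝ
  /-- the posterior means of the weights (one per basis function and output channel) -/
  μω : Fin M → Out ny
  /-- output constraint set -/
  Y : Set (Out ny)
  /-- input constraint set -/
  U : Set (Inp nu)
  /-- output reference -/
  yr : Out ny
  /-- input reference -/
  ur : Inp nu
  /-- tracking cost, a function of the deviations from the reference -/
  ls : NState na nb ny nu → Inp nu → ℝ
  /-- output barrier cost -/
  lb : Out ny → ℝ
  /-- terminal control law -/
  κf : NState na nb ny nu → Inp nu
  /-- terminal cost, a function of the deviation from the reference -/
  Vf : NState na nb ny nu → ℝ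
  /-- weight of the terminal cost -/
  lam : ℝ
  /-- control horizon -/
  Nc : ℕ
  /-- prediction horizon -/
  Np : ℕ

namespace NSVBMPC

variable {na nb ny nu M : ℕ} (P : NSVBMPC na nb ny nu M)

/-- The predicted output `ŷ_{k+1} = 𝔼[y_{k+1}] = ∑ₘ φ_m(x_k, u_k) μ_m`. -/
def f (x : NState na nb ny nu) (u : Inp nu) : Out ny := ∑ m, P.φ m x u • P.μω m

/-- The nominal model `x_{k+1} = F(x_k, u_k)`. -/
def F (x : NState na nb ny nu) (u : Inp nu) : NState na nb ny nu := x.push (P.f x u) u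

/-- The reference state `(y_r, …, y_r, u_r, …, u_r)`. -/
def xr : NState na nb ny nu := NState.mk (fun _ => P.yr) (fun _ => P.ur)

/-- The state constraint set `𝒳 = 𝒴^{n_a+1} × 𝒰^{n_b}`. -/
def X : Set (NState na nb ny nu) := {x | (∀ i, x.out i ∈ P.Y) ∧ ∀ j, x.inp j ∈ P.U}

/-- The stage cost `ℓ(x, u) = ℓ_s(x - x_r, u - u_r) + ℓ_b(y)`, `y` the current output. -/
def l (x : NState na nb ny nu) (u : Inp nu) : ℝ := P.ls (x - P.xr) (u - P.ur) + P.lb (x.out 0)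

/-- The input applied at prediction step `j` in the predicted state `z`: a free decision for
`j < N_c`, the terminal law afterwards. -/
def ctrl (v : Fin P.Nc → Inp nu) (j : ℕ) (z : NState na nb ny nu) : Inp nu :=
  if h : j < P.Nc then v ⟨j, h⟩ else P.κf z

/-- The predicted states from `x` under the decisions `v`. -/
def pred (x : NState na nb ny nu) (v : Fin P.Nc → Inp nu) : ℕ → NState na nb ny nu
  | 0 => x
  | j + 1 => P.F (pred x v j) (P.ctrl v j (pred x v j))

/-- The input at step `j` of the prediction from `x` under `v`. -/
def predInput (x : NState na nb ny nu) (v : Fin P.Nc → Inp nu) (j : ℕ) : Inp nu :=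
  P.ctrl v j (P.pred x v j)

/-- The state and input constraints of the problem (there is no terminal constraint). -/
def Feasible (x : NState na nb ny nu) (v : Fin P.Nc → Inp nu) : Prop :=
  ∀ j < P.Np, P.pred x v j ∈ P.X ∧ P.predInput x v j ∈ P.U

/-- The cost
`J = ∑_{i < N_c} ℓ(x̂_i, u_i) + ∑_{N_c ≤ i < N_p} ℓ(x̂_i, κ_f(x̂_i)) + λ V_f(x̂_{N_p} - x_r)`. -/
def cost (x : NState na nb ny nu) (v : Fin P.Nc → Inp nu) : ℝ :=
  ∑ i ∈ Finset.range P.Np, P.l (P.pred x v i) (P.predInput x v i)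
    + P.lam * P.Vf (P.pred x v P.Np - P.xr)

/-- `v` solves the optimal control problem at `x`. -/
def IsOptimal (x : NState na nb ny nu) (v : Fin P.Nc → Inp nu) : Prop :=
  P.Feasible x v ∧ ∀ w, P.Feasible x w → P.cost x v ≤ P.cost x w

/-- The optimal cost (meant for `x` at which the problem is feasible). -/
def optCost (x : NState na nb ny nu) : ℝ := sInf {c | ∃ v, P.Feasible x v ∧ P.cost x v = c}

/-- The terminal region `Ω_ϑ = {x : V_f(x - x_r) ≤ ϑ}`. -/
def termRegion (ϑ : ℝ) : Set (NState na nb ny nu) := {x | P.Vf (x - P.xr) ≤ ϑ}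

/-- The region `X_{N_c,N_p}(λ)` of the problem without terminal constraint: the feasible states
whose optimal cost is at most `N_p d + λ ϑ`, where `d` bounds the stage cost from below outside
the terminal region `Ω_ϑ`. -/
def region (ϑ d : ℝ) : Set (NState na nb ny nu) :=
  {x | (∃ v, P.Feasible x v) ∧ P.optCost x ≤ P.Np * d + P.lam * ϑ}

/-- `κ` is a predictive controller on `S`: at each state of `S` it applies the first input of
some optimal solution. -/
def IsPredictiveController (κ : NState na nb ny nu → Inp nu) (S : Set (NState na nb ny nu)) :
    Prop :=
  ∀ x ∈ S, ∃ v, P.IsOptimal x v ∧ κ x = P.predInput x v 0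

/-- The terminal ingredients on `Ω_ϑ`. -/
def TerminalIngredients (ϑ : ℝ) : Prop :=
  P.xr ∈ interior (P.termRegion ϑ) ∧
  (∃ α₁ α₂, IsClassKInfty α₁ ∧ IsClassKInfty α₂ ∧ ∀ x ∈ P.termRegion ϑ,
    α₁ ‖x - P.xr‖ ≤ P.Vf (x - P.xr) ∧ P.Vf (x - P.xr) ≤ α₂ ‖x - P.xr‖) ∧
  ∀ x ∈ P.termRegion ϑ,
    P.Vf (P.F x (P.κf x) - P.xr) - P.Vf (x - P.xr) ≤ - P.ls (x - P.xr) (P.κf x - P.ur) ∧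
    P.κf x ∈ P.U

/-- The successor of `x` in the true closed loop when the prediction error is `δ`: the true
output is `y_{k+1} = ŷ_{k+1} + δ_k`. -/
def trueStep (κ : NState na nb ny nu → Inp nu) (x : NState na nb ny nu) (δ : Out ny) :
    NState na nb ny nu :=
  x.push (P.f x (κ x) + δ) (κ x)

/-- `Ω` is robustly invariant for the closed loop under prediction errors bounded by `ν`. -/
def RobustInvariant (κ : NState na nb ny nu → Inp nu) (ν : ℝ) (Ω : Set (NState na nb ny nu)) :
    Prop :=
  ∀ x ∈ Ω, ∀ δ : Out ny, ‖δ‖ ≤ ν → P.trueStep κ x δ ∈ Ω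

/-- Input-to-state stability in `Ω` of the closed loop with respect to prediction errors bounded
by `ν`. -/
def ISSOn (κ : NState na nb ny nu → Inp nu) (ν : ℝ) (Ω : Set (NState na nb ny nu)) : Prop :=
  ∃ (β : ℝ → ℕ → ℝ) (γ : ℝ → ℝ), IsClassKL β ∧ IsClassK γ ∧
    ∀ (x : ℕ → NState na nb ny nu) (δ : ℕ → Out ny), x 0 ∈ Ω → (∀ k, ‖δ k‖ ≤ ν) →
      (∀ k, x (k + 1) = P.trueStep κ (x k) (δ k)) →
      ∀ k, ‖x k - P.xr‖ ≤ β ‖x 0 - P.xr‖ k + γ (⨆ i, ‖δ i‖)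

end NSVBMPC

/-- `g(x, u)` is uniformly continuous with respect to `x ∈ S`, uniformly over `u ∈ U`. -/
def UnifContInState {E G H : Type*} [PseudoMetricSpace E] [PseudoMetricSpace H]
    (g : E → G → H) (S : Set E) (U : Set G) : Prop :=
  ∀ ε > 0, ∃ η > 0, ∀ x ∈ S, ∀ x' ∈ S, dist x x' < η → ∀ u ∈ U, dist (g x u) (g x' u) < ε

end

/-! The optimal cost is an ISS Lyapunov function on a sublevel set `Ω = {optCost ≤ c}`. It is
bounded below by its first stage cost and, near the reference, above by the cost of the terminal
law, at most `λ α₂` (`termInputs_feasible_cost_le`). A small `c` replaces the missing terminal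
constraint: every predicted state stays near `xr`, and the last one lies in a level set of `Vf`
invariant under `κf`. Shifting an optimal decision and appending `κf` is then feasible at the
nominal successor. Since `λ ≥ 1`, the decrease of `λ Vf` pays for the appended stage, and the cost
drops by at least `αx ‖x - xr‖` (`cost_shift`). A prediction error moves the successor by exactly
`‖δ‖`. By uniform continuity the same shifted decision stays feasible there and costs at most `ε`
more (`exists_cost_close`), so continuity of the optimal cost is never needed. This gives invariance
of `Ω`; `exists_iss_gains` turns the ε-η decrease into class-`𝒦ℒ` and class-`𝒦` gains. -/

noncomputable section

/-! ### Comparison functions. -/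

namespace IsClassK

variable {α β : ℝ → ℝ}

lemma mono (h : IsClassK α) {a b : ℝ} (ha : 0 ≤ a) (hab : a ≤ b) : α a ≤ α b :=
  h.2.1.monotoneOn ha (Set.mem_Ici.2 (ha.trans hab)) hab

lemma nonneg (h : IsClassK α) {a : ℝ} (ha : 0 ≤ a) : 0 ≤ α a :=
  h.2.2 ▸ h.mono le_rfl ha

lemma pos (h : IsClassK α) {a : ℝ} (ha : 0 < a) : 0 < α a :=
  h.2.2 ▸ h.2.1 Set.self_mem_Ici (Set.mem_Ici.2 ha.le) ha

lemma lt_of_lt (h : IsClassK α) {a b : ℝ} (ha : 0 ≤ a) (hb : 0 ≤ b) (hab : α a < α b) : a < b :=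
  (h.2.1.lt_iff_lt ha hb).1 hab

lemma comp (hα : IsClassK α) (hβ : IsClassK β) : IsClassK (fun s => α (β s)) := by
  have hm : Set.MapsTo β (Set.Ici 0) (Set.Ici 0) := fun s hs => hβ.nonneg hs
  refine ⟨hα.1.comp hβ.1 hm, fun a ha b hb hab => hα.2.1 (hm ha) (hm hb) (hβ.2.1 ha hb hab), ?_⟩
  simp [hβ.2.2, hα.2.2]

lemma add (hα : IsClassK α) (hβ : IsClassK β) : IsClassK (fun s => α s + β s) :=
  ⟨hα.1.add hβ.1, fun _ ha _ hb hab => add_lt_add (hα.2.1 ha hb hab) (hβ.2.1 ha hb hab),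
    by simp [hα.2.2, hβ.2.2]⟩

lemma const_mul (hα : IsClassK α) {a : ℝ} (ha : 0 < a) : IsClassK (fun s => a * α s) :=
  ⟨continuousOn_const.mul hα.1, fun _ hs _ ht hst => mul_lt_mul_of_pos_left (hα.2.1 hs ht hst) ha,
    by simp [hα.2.2]⟩

lemma exists_pos_lt (h : IsClassK α) {ε : ℝ} (hε : 0 < ε) : ∃ r, 0 < r ∧ α r < ε := by
  have h0 : Tendsto α (𝓝[≥] 0) (𝓝 0) := by
    have := h.1 0 Set.self_mem_Ici
    rwa [ContinuousWithinAt, h.2.2] at this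
  have h1 : ∀ᶠ s in 𝓝[>] (0 : ℝ), α s < ε :=
    (h0.mono_left (nhdsWithin_mono _ Set.Ioi_subset_Ici_self)).eventually_lt_const hε
  obtain ⟨r, hr, hr0⟩ := (h1.and self_mem_nhdsWithin).exists
  exact ⟨r, hr0, hr⟩

/-- Class-`𝒦` functions need not be subadditive. This turns the maximum of a transient and an
ultimate bound into the sum of the ISS estimate. -/
lemma max_le_add (h : IsClassK α) {a b : ℝ} (ha : 0 ≤ a) (hb : 0 ≤ b) :
    α (max a b) ≤ α a + α b := by
  rcases le_total a b with hab | hab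
  · rw [max_eq_right hab]; linarith [h.nonneg ha]
  · rw [max_eq_left hab]; linarith [h.nonneg hb]

lemma id : IsClassK (fun s => s) :=
  ⟨continuousOn_id, fun _ _ _ _ h => h, rfl⟩

lemma iterate (h : IsClassK α) (k : ℕ) : IsClassK (α^[k]) := by
  induction k with
  | zero => exact id
  | succ k ih => exact ih.comp h

end IsClassK

/-- A bounded family `a` that is uniformly small where `b` is small is bounded by a class-`𝒦`
function of `b`. -/
lemma exists_isClassK_bound {ι : Type*} (a b : ι → ℝ) {A : ℝ} (hA : ∀ i, a i ≤ A)
    (hb : ∀ i, 0 ≤ b i) (h : ∀ ε > 0, ∃ η > 0, ∀ i, b i ≤ η → a i ≤ ε) :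
    ∃ γ, IsClassK γ ∧ ∀ i, a i ≤ γ (b i) := by
  -- Intercepts and slopes of affine majorants. Their infimum `g` is a concave majorant, and
  -- arbitrarily small intercepts make it vanish continuously at `0`.
  let S : Set (ℝ × ℝ) := {q | 0 ≤ q.1 ∧ 0 ≤ q.2 ∧ ∀ i, a i ≤ q.1 + q.2 * b i}
  have hS : ∀ ε > 0, ∃ L, (ε, L) ∈ S := by
    intro ε hε
    obtain ⟨η, hη, hi⟩ := h ε hε
    -- Where `b i ≥ η`, the slope term alone exceeds `A`.
    refine ⟨|A| / η, hε.le, by positivity, fun i => ?_⟩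
    rcases le_total (b i) η with hbi | hbi
    · have := hi i hbi
      have : 0 ≤ |A| / η * b i := mul_nonneg (by positivity) (hb i)
      dsimp only; linarith
    · have h1 : |A| ≤ |A| / η * b i := by
        rw [div_mul_eq_mul_div, le_div_iff₀ hη]
        exact mul_le_mul_of_nonneg_left hbi (abs_nonneg A)
      have := hA i
      have := le_abs_self A
      dsimp only; linarith
  obtain ⟨L₁, hL₁⟩ := hS 1 one_pos
  have : Nonempty S := ⟨⟨_, hL₁⟩⟩
  let g : ℝ → ℝ := fun s => ⨅ q : S, (q.1.1 + q.1.2 * s)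
  have hbdd : ∀ s, 0 ≤ s → BddBelow (Set.range fun q : S => q.1.1 + q.1.2 * s) := by
    rintro s hs
    refine ⟨0, ?_⟩
    rintro _ ⟨q, rfl⟩
    exact add_nonneg q.2.1 (mul_nonneg q.2.2.1 hs)
  have hg_le : ∀ s, 0 ≤ s → ∀ q ∈ S, g s ≤ q.1 + q.2 * s := fun s hs q hq =>
    ciInf_le (hbdd s hs) ⟨q, hq⟩
  have hg0 : ∀ s, 0 ≤ s → 0 ≤ g s := fun s hs =>
    le_ciInf fun q => add_nonneg q.2.1 (mul_nonneg q.2.2.1 hs)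
  have hmono : ∀ s t, 0 ≤ s → s ≤ t → g s ≤ g t := fun s t hs hst =>
    le_ciInf fun q => (hg_le s hs q.1 q.2).trans
      (by have := mul_le_mul_of_nonneg_left hst q.2.2.1; linarith)
  -- `g t / t` is nonincreasing. Together with monotonicity this squeezes `g` near a positive point,
  -- which gives continuity there.
  have hscale : ∀ s t, 0 < s → s ≤ t → g t ≤ t / s * g s := by
    intro s t hs hst
    have ht : 0 < t := hs.trans_le hst
    have : s / t * g t ≤ g s := by
      refine le_ciInf fun q => ?_
      have h1 := hg_le t ht.le q.1 q.2
      have h2 : s / t * g t ≤ s / t * (q.1.1 + q.1.2 * t) :=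
        mul_le_mul_of_nonneg_left h1 (by positivity)
      have h3 : s / t * (q.1.1 + q.1.2 * t) = s / t * q.1.1 + q.1.2 * s := by field_simp
      have h4 : s / t * q.1.1 ≤ 1 * q.1.1 :=
        mul_le_mul_of_nonneg_right ((div_le_one ht).2 hst) q.2.1
      linarith
    calc g t = t / s * (s / t * g t) := by field_simp
      _ ≤ t / s * g s := mul_le_mul_of_nonneg_left this (by positivity)
  have hg00 : g 0 = 0 := by
    refine le_antisymm (le_of_forall_pos_le_add fun ε hε => ?_) (hg0 0 le_rfl)
    obtain ⟨L, hL⟩ := hS ε hε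
    simpa using hg_le 0 le_rfl _ hL
  have hcont : ContinuousOn g (Set.Ici 0) := by
    intro s hs
    rcases (Set.mem_Ici.1 hs).eq_or_lt with rfl | hs
    · rw [ContinuousWithinAt, hg00, Metric.tendsto_nhdsWithin_nhds]
      intro ε hε
      obtain ⟨L, hL⟩ := hS (ε / 2) (half_pos hε)
      have hL0 : 0 ≤ L := hL.2.1
      refine ⟨ε / (2 * (L + 1)), by positivity, fun t ht hd => ?_⟩
      rw [Real.dist_eq, sub_zero] at hd ⊢
      rw [abs_of_nonneg (hg0 t ht)]
      rw [abs_of_nonneg ht, lt_div_iff₀ (by positivity)] at hd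
      have ht0 : 0 ≤ t := ht
      have := hg_le t ht _ hL
      dsimp only at this
      nlinarith
    · refine ContinuousAt.continuousWithinAt ?_
      have hlow : Tendsto (fun t => min (t / s) 1 * g s) (𝓝 s) (𝓝 (g s)) := by
        have : ContinuousAt (fun t => min (t / s) 1 * g s) s := by fun_prop
        simpa [ContinuousAt, div_self hs.ne'] using this
      have hupp : Tendsto (fun t => max (t / s) 1 * g s) (𝓝 s) (𝓝 (g s)) := by
        have : ContinuousAt (fun t => max (t / s) 1 * g s) s := by fun_prop
        simpa [ContinuousAt, div_self hs.ne'] using this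
      refine tendsto_of_tendsto_of_tendsto_of_le_of_le' hlow hupp ?_ ?_
      · filter_upwards [lt_mem_nhds hs] with t ht
        rcases le_total s t with hst | hst
        · rw [min_eq_right ((one_le_div hs).2 hst), one_mul]
          exact hmono s t hs.le hst
        · rw [min_eq_left ((div_le_one hs).2 hst)]
          have := mul_le_mul_of_nonneg_left (hscale t s ht hst) (div_pos ht hs).le
          rwa [show t / s * (s / t * g t) = g t by field_simp] at this
      · filter_upwards [lt_mem_nhds hs] with t ht
        rcases le_total s t with hst | hst
        · rw [max_eq_left ((one_le_div hs).2 hst)]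
          exact hscale s t hs hst
        · rw [max_eq_right ((div_le_one hs).2 hst), one_mul]
          exact hmono t s ht.le hst
  -- Adding the identity makes the monotone `g` strictly increasing.
  refine ⟨fun s => g s + s, ⟨hcont.add continuousOn_id, fun s hs t _ hst => ?_, by simp [hg00]⟩,
    fun i => ?_⟩
  · exact add_lt_add_of_le_of_lt (hmono s t hs hst.le) hst
  · have : a i ≤ g (b i) := le_ciInf fun q => q.2.2.2 i
    linarith [hb i]

/-- A `1`-Lipschitz, positive definite minorant of `a` as a function of `v`. -/
lemma exists_lipschitz_minorant {ι : Type*} (v a : ι → ℝ) (ha : ∀ i, 0 ≤ a i) {i₀ : ι}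
    (hv₀ : v i₀ = 0) (ha₀ : a i₀ = 0) (h : ∀ e > 0, ∃ m > 0, ∀ i, e ≤ v i → m ≤ a i) :
    ∃ p : ℝ → ℝ, LipschitzWith 1 p ∧ p 0 = 0 ∧ (∀ s, 0 < s → 0 < p s) ∧ ∀ i, p (v i) ≤ a i := by
  have : Nonempty ι := ⟨i₀⟩
  -- The infimal convolution of `a` with the absolute value: the largest `1`-Lipschitz minorant.
  let p : ℝ → ℝ := fun s => ⨅ i, (a i + |s - v i|)
  have hbdd : ∀ s, BddBelow (Set.range fun i => a i + |s - v i|) := fun s =>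
    ⟨0, by rintro _ ⟨i, rfl⟩; exact add_nonneg (ha i) (abs_nonneg _)⟩
  have hp_le : ∀ s i, p s ≤ a i + |s - v i| := fun s i => ciInf_le (hbdd s) i
  refine ⟨p, LipschitzWith.of_le_add fun s t => ?_, le_antisymm ?_ ?_, fun s hs => ?_, fun i => ?_⟩
  · rw [← sub_le_iff_le_add]
    refine le_ciInf fun i => ?_
    have := hp_le s i
    have := abs_sub_le s t (v i)
    rw [Real.dist_eq]; linarith
  · simpa [hv₀, ha₀] using hp_le 0 i₀
  · exact le_ciInf fun i => add_nonneg (ha i) (abs_nonneg _)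
  · obtain ⟨m, hm, hi⟩ := h (s / 2) (half_pos hs)
    refine (lt_min hm (half_pos hs)).trans_le (le_ciInf fun i => ?_)
    rcases le_total (s / 2) (v i) with hvi | hvi
    · exact (min_le_left _ _).trans (by have := hi i hvi; have := abs_nonneg (s - v i); linarith)
    · exact (min_le_right _ _).trans (by have := ha i; have := le_abs_self (s - v i); linarith)
  · simpa using hp_le (v i) i

/-- The iterates of a class-`𝒦` map below the identity form a class-`𝒦ℒ` function. -/
lemma IsClassK.isClassKL_iterate {T : ℝ → ℝ} (hT : IsClassK T) (hlt : ∀ s, 0 < s → T s < s)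
    {α β : ℝ → ℝ} (hα : IsClassK α) (hβ : IsClassK β) :
    IsClassKL (fun s k => α (T^[k] (β s))) := by
  have hle : ∀ s, 0 ≤ s → T s ≤ s := fun s hs => by
    rcases hs.eq_or_lt with rfl | hs
    · exact hT.2.2.le
    · exact (hlt s hs).le
  refine ⟨fun k => hα.comp ((hT.iterate k).comp hβ), fun s hs => ?_⟩
  have hβs := hβ.nonneg hs
  have hnn : ∀ k, 0 ≤ T^[k] (β s) := fun k => (hT.iterate k).nonneg hβs
  have hanti : Antitone fun k => T^[k] (β s) := antitone_nat_of_succ_le fun k => by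
    rw [Function.iterate_succ_apply']
    exact hle _ (hnn k)
  refine ⟨fun k l hkl => hα.mono (hnn l) (hanti hkl), ?_⟩
  have hbdd : BddBelow (Set.range fun k => T^[k] (β s)) := ⟨0, by rintro _ ⟨k, rfl⟩; exact hnn k⟩
  have hlim := tendsto_atTop_ciInf hanti hbdd
  set L := ⨅ k, T^[k] (β s)
  have hL : 0 ≤ L := le_ciInf hnn
  have key : ∀ {g : ℝ → ℝ}, IsClassK g → Tendsto (fun k => g (T^[k] (β s))) atTop (𝓝 (g L)) :=
    fun hg => (hg.1 L hL).tendsto.comp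
      (tendsto_nhdsWithin_iff.2 ⟨hlim, Eventually.of_forall hnn⟩)
  have hfix : T L = L := by
    refine tendsto_nhds_unique (key hT) ?_
    have := hlim.comp (tendsto_add_atTop_nat 1)
    simpa only [Function.comp_def, Function.iterate_succ_apply'] using this
  have hL0 : L = 0 := by
    by_contra hne
    exact absurd hfix (hlt L (lt_of_le_of_ne hL (Ne.symm hne))).ne
  have := key hα
  rwa [hL0, hα.2.2] at this

/-! ### From a Lyapunov decrease to input-to-state stability. -/

/-- A Lyapunov function with a decrease up to an error that vanishes with the disturbance gives
input-to-state stability. -/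
theorem exists_iss_gains {E G : Type*} [SeminormedAddCommGroup G] {Ω : Set E} {n V : E → ℝ}
    {step : E → G → E} {α₁ α₂ : ℝ → ℝ} {r ν : ℝ} {z : E}
    (hα₁ : IsClassK α₁) (hα₂ : IsClassK α₂) (hn : ∀ x, 0 ≤ n x) (hz : z ∈ Ω) (hnz : n z = 0)
    (hnr : ∀ x ∈ Ω, n x ≤ r)
    (hlow : ∀ x ∈ Ω, α₁ (n x) ≤ V x) (hupp : ∀ x ∈ Ω, V x ≤ α₂ (n x))
    (hinv : ∀ x ∈ Ω, ∀ δ, ‖δ‖ ≤ ν → step x δ ∈ Ω)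
    (hdec : ∀ ε > 0, ∃ η > 0, ∀ x ∈ Ω, ∀ δ, ‖δ‖ ≤ ν → ‖δ‖ ≤ η →
      V (step x δ) ≤ V x - α₁ (n x) + ε) :
    ∃ (β : ℝ → ℕ → ℝ) (γ : ℝ → ℝ), IsClassKL β ∧ IsClassK γ ∧
      ∀ (x : ℕ → E) (δ : ℕ → G), x 0 ∈ Ω → (∀ k, ‖δ k‖ ≤ ν) →
        (∀ k, x (k + 1) = step (x k) (δ k)) →
        ∀ k, n (x k) ≤ β (n (x 0)) k + γ (⨆ i, ‖δ i‖) := by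
  have hV0 : ∀ x ∈ Ω, 0 ≤ V x := fun x hx => (hα₁.nonneg (hn x)).trans (hlow x hx)
  have hVr : ∀ x ∈ Ω, V x ≤ α₂ r := fun x hx => (hupp x hx).trans (hα₂.mono (hn x) (hnr x hx))
  have hVz : V z = 0 := le_antisymm (by simpa [hnz, hα₂.2.2] using hupp z hz) (hV0 z hz)
  obtain ⟨p, hpL, hp0, hppos, hp⟩ := exists_lipschitz_minorant (ι := Ω) (fun x => V x)
    (fun x => α₁ (n x)) (fun x => hα₁.nonneg (hn x)) (i₀ := ⟨z, hz⟩) hVz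
    (by simp [hnz, hα₁.2.2]) (by
      intro e he
      obtain ⟨s, hs, hse⟩ := hα₂.exists_pos_lt he
      refine ⟨α₁ s, hα₁.pos hs, fun x hx => hα₁.mono hs.le ?_⟩
      exact (hα₂.lt_of_lt hs.le (hn x) (hse.trans_le (hx.trans (hupp x x.2)))).le)
  have hp_nonneg : ∀ s, 0 ≤ s → 0 ≤ p s := fun s hs => by
    rcases hs.eq_or_lt with rfl | hs
    · exact hp0.ge
    · exact (hppos s hs).le
  -- the comparison map
  let T : ℝ → ℝ := fun s => s - p s / 2
  -- As `p` is `1`-Lipschitz, `T` has slope at least `1/2`. Half of the decrease is kept in `T`; the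
  -- other half pays for the disturbance.
  have hT : IsClassK T := by
    refine ⟨(continuous_id.sub (hpL.continuous.div_const 2)).continuousOn, ?_, by simp [T, hp0]⟩
    intro s _ t _ hst
    have h1 := hpL.le_add_mul t s
    rw [Real.dist_eq, abs_of_pos (sub_pos.2 hst)] at h1
    simp only [NNReal.coe_one, one_mul] at h1
    simp only [T]; linarith
  have hTlt : ∀ s, 0 < s → T s < s := fun s hs => by
    have := hppos s hs
    simp only [T]; linarith
  -- the norm in terms of the Lyapunov function
  obtain ⟨γ₁, hγ₁, hγ₁n⟩ := exists_isClassK_bound (ι := Ω) (fun x => n x) (fun x => V x)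
    (A := r) (fun x => hnr x x.2) (fun x => hV0 x x.2) (by
      intro ε hε
      refine ⟨α₁ ε / 2, half_pos (hα₁.pos hε), fun x hx => ?_⟩
      refine (hα₁.lt_of_lt (hn x) hε.le ?_).le
      have := hα₁.pos hε
      have := hlow x x.2
      linarith)
  -- the disturbance gain of the decrease
  obtain ⟨ω, hω, hωV⟩ := exists_isClassK_bound
    (ι := Ω × {δ : G // ‖δ‖ ≤ ν}) (fun q => V (step q.1 q.2) - V q.1 + p (V q.1))
    (fun q => ‖(q.2 : G)‖) (A := α₂ r) (fun q => by
      have h1 := hVr _ (hinv q.1 q.1.2 q.2 q.2.2)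
      have h2 := hp q.1
      have h3 := hlow q.1 q.1.2
      linarith) (fun q => norm_nonneg _) (by
      intro ε hε
      obtain ⟨η, hη, hd⟩ := hdec ε hε
      refine ⟨η, hη, fun q hq => ?_⟩
      have h1 := hd q.1 q.1.2 q.2 q.2.2 hq
      have h2 := hp q.1
      linarith)
  -- the Lyapunov function in terms of its decrease
  obtain ⟨γ₂, hγ₂, hγ₂p⟩ := exists_isClassK_bound (ι := Set.Icc 0 (α₂ r)) (fun s => s.1)
    (fun s => p s.1) (A := α₂ r) (fun s => s.2.2) (fun s => hp_nonneg s s.2.1) (by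
      intro ε hε
      rcases lt_or_ge (α₂ r) ε with h | h
      · exact ⟨1, one_pos, fun s _ => s.2.2.trans h.le⟩
      obtain ⟨t, ht, hmin⟩ := isCompact_Icc.exists_isMinOn (Set.nonempty_Icc.2 h)
        hpL.continuous.continuousOn
      have hpt := hppos t (hε.trans_le ht.1)
      refine ⟨p t / 2, half_pos hpt, fun s hs => ?_⟩
      by_contra! hlt
      have : p t ≤ p s := hmin (show s.1 ∈ Set.Icc ε (α₂ r) from ⟨hlt.le, s.2.2⟩)
      linarith)
  -- The ultimate bound: if `p (V x) < 2 * ω D`, then `V x ≤ γ₂ (2 * ω D)`, and one step adds at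
  -- most `ω D`. Otherwise the step contracts by `T`.
  have hB : IsClassK (fun D => γ₂ (2 * ω D) + ω D) :=
    (hγ₂.comp (hω.const_mul two_pos)).add hω
  refine ⟨_, _, hT.isClassKL_iterate hTlt hγ₁ hα₂, hγ₁.comp hB, fun x δ hx0 hδ hstep k => ?_⟩
  set D := ⨆ i, ‖δ i‖
  have hδD : ∀ k, ‖δ k‖ ≤ D := fun k => le_ciSup ⟨ν, by rintro _ ⟨i, rfl⟩; exact hδ i⟩ k
  have hD : 0 ≤ D := (norm_nonneg _).trans (hδD 0)
  have hxΩ : ∀ k, x k ∈ Ω := by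
    intro k
    induction k with
    | zero => exact hx0
    | succ k ih => rw [hstep]; exact hinv _ ih _ (hδ k)
  set B := γ₂ (2 * ω D) + ω D
  have hB0 : 0 ≤ B := hB.nonneg hD
  have hV : ∀ k, V (x k) ≤ max (T^[k] (α₂ (n (x 0)))) B := by
    intro k
    induction k with
    | zero => exact le_max_of_le_left (hupp _ hx0)
    | succ k ih =>
      have h1 := hωV (⟨x k, hxΩ k⟩, ⟨δ k, hδ k⟩)
      dsimp only at h1
      rw [← hstep] at h1
      have h2 := hω.mono (norm_nonneg _) (hδD k)
      rcases lt_or_ge (p (V (x k))) (2 * ω D) with hlt | hge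
      · refine le_max_of_le_right ?_
        have h3 := hγ₂p ⟨V (x k), hV0 _ (hxΩ k), hVr _ (hxΩ k)⟩
        have h4 := hγ₂.mono (hp_nonneg _ (hV0 _ (hxΩ k))) hlt.le
        have h5 := hp_nonneg _ (hV0 _ (hxΩ k))
        dsimp only at h3
        simp only [B]; linarith
      · have h3 : V (x (k + 1)) ≤ T (V (x k)) := by simp only [T]; linarith
        refine h3.trans ((hT.mono (hV0 _ (hxΩ k)) ih).trans ?_)
        rw [Function.iterate_succ_apply']
        rcases le_total (T^[k] (α₂ (n (x 0)))) B with h | h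
        · rw [max_eq_right h]
          have := hp_nonneg B hB0
          exact le_max_of_le_right (by simp only [T]; linarith)
        · rw [max_eq_left h]
          exact le_max_left _ _
  calc n (x k) ≤ γ₁ (V (x k)) := hγ₁n ⟨x k, hxΩ k⟩
    _ ≤ γ₁ (max (T^[k] (α₂ (n (x 0)))) B) := hγ₁.mono (hV0 _ (hxΩ k)) (hV k)
    _ ≤ _ := hγ₁.max_le_add ((hT.iterate k).nonneg (hα₂.nonneg (hn _))) hB0

/-! ### Norms of NARX states. -/

namespace NState

variable {na nb ny nu : ℕ}

lemma norm_out_sub_le (x x' : NState na nb ny nu) (i : Fin (na + 1)) :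
    ‖x.out i - x'.out i‖ ≤ ‖x - x'‖ := by
  rw [EuclideanSpace.norm_eq, EuclideanSpace.norm_eq]
  refine Real.sqrt_le_sqrt ?_
  rw [Fintype.sum_sum_type, Fintype.sum_prod_type]
  refine le_trans ?_ (le_add_of_nonneg_right (Finset.sum_nonneg fun _ _ => sq_nonneg _))
  exact Finset.single_le_sum (f := fun i => ∑ c, ‖(x - x') (Sum.inl (i, c))‖ ^ 2)
    (fun _ _ => Finset.sum_nonneg fun _ _ => sq_nonneg _) (Finset.mem_univ i)

/-- The error enters only the newest output block; all other blocks of the two states coincide. -/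
lemma norm_push_add_sub_push (x : NState na nb ny nu) (y δ : Out ny) (u : Inp nu) :
    ‖x.push (y + δ) u - x.push y u‖ = ‖δ‖ := by
  rw [EuclideanSpace.norm_eq, EuclideanSpace.norm_eq, Fintype.sum_sum_type, Fintype.sum_prod_type,
    Fin.sum_univ_succ]
  congr 1
  have h : ∀ i : Fin na, (i.succ.castSucc) = (i.castSucc).succ := fun i => rfl
  simp [push, mk, h]

end NState

/-! ### Constraints, costs and inputs. -/

namespace NSVBMPC

variable {na nb ny nu M : ℕ} {P : NSVBMPC na nb ny nu M}

/-- Meant for states that feasibility does not constrain, such as the last predicted one. Closeness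
to `xr` gives the output constraints; the inputs come from `x` and `u`. -/
lemma push_mem_X {r : ℝ} (hY : Metric.closedBall P.yr r ⊆ P.Y) {x : NState na nb ny nu}
    (hx : x ∈ P.X) {y : Out ny} {u : Inp nu} (hu : u ∈ P.U)
    (hr : ‖x.push y u - P.xr‖ ≤ r) : x.push y u ∈ P.X := by
  refine ⟨fun i => hY ?_, fun j => ?_⟩
  · rw [mem_closedBall_iff_norm]
    exact (NState.norm_out_sub_le (x.push y u) P.xr i).trans hr
  · change Fin.cons (α := fun _ => Inp nu) u x.inp j.castSucc ∈ P.U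
    generalize j.castSucc = k
    refine Fin.cases ?_ (fun j => ?_) k
    · exact hu
    · exact hx.2 j

lemma xr_mem_X (hyr : P.yr ∈ P.Y) (hur : P.ur ∈ P.U) : P.xr ∈ P.X :=
  ⟨fun _ => hyr, fun _ => hur⟩

lemma termRegion_Vf_nonneg {ϑ : ℝ} (hϑ : 0 < ϑ) {α : ℝ → ℝ} (hα : IsClassK α)
    (h : ∀ x ∈ P.termRegion ϑ, α ‖x - P.xr‖ ≤ P.Vf (x - P.xr)) (x : NState na nb ny nu) :
    0 ≤ P.Vf (x - P.xr) := by
  by_cases hx : x ∈ P.termRegion ϑ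
  · exact (hα.nonneg (norm_nonneg _)).trans (h x hx)
  · exact hϑ.le.trans (not_le.1 hx).le

lemma l_eq_ls (hb0 : ∀ y ∈ P.Y, P.lb y = 0) {x : NState na nb ny nu} (hx : x ∈ P.X)
    (u : Inp nu) : P.l x u = P.ls (x - P.xr) (u - P.ur) := by
  rw [l, hb0 _ (hx.1 0), add_zero]

lemma ctrl_of_le (v : Fin P.Nc → Inp nu) {j : ℕ} (hj : P.Nc ≤ j) (z : NState na nb ny nu) :
    P.ctrl v j z = P.κf z := dif_neg hj.not_gt

lemma ctrl_of_lt (v : Fin P.Nc → Inp nu) {j : ℕ} (hj : j < P.Nc) (z : NState na nb ny nu) :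
    P.ctrl v j z = v ⟨j, hj⟩ := dif_pos hj

/-! ### The terminal law near the reference -/

/-- The terminal law applied in open loop. -/
def termInputs (P : NSVBMPC na nb ny nu M) (x : NState na nb ny nu) : Fin P.Nc → Inp nu :=
  fun j => P.κf ((fun z => P.F z (P.κf z))^[j] x)

lemma ctrl_termInputs (x : NState na nb ny nu) (j : ℕ) :
    P.ctrl (P.termInputs x) j ((fun z => P.F z (P.κf z))^[j] x) =
      P.κf ((fun z => P.F z (P.κf z))^[j] x) := by
  rcases lt_or_ge j P.Nc with h | h
  · rw [ctrl_of_lt _ h]; rfl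
  · rw [ctrl_of_le _ h]

lemma pred_termInputs (x : NState na nb ny nu) (j : ℕ) :
    P.pred x (P.termInputs x) j = (fun z => P.F z (P.κf z))^[j] x := by
  induction j with
  | zero => rfl
  | succ j ih =>
    rw [pred, ih, ctrl_termInputs, Function.iterate_succ_apply']

/-- Small level sets of the terminal cost within the constraints are invariant under the
terminal law, which decreases the terminal cost by the stage cost. -/
lemma term_step {r ϑ t : ℝ} (hY : Metric.closedBall P.yr r ⊆ P.Y) (hr : 0 ≤ r)
    (hb0 : ∀ y ∈ P.Y, P.lb y = 0) (hl0 : ∀ x ∈ P.X, ∀ u ∈ P.U, 0 ≤ P.l x u)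
    {α₁ : ℝ → ℝ} (hα₁ : IsClassK α₁)
    (hlow : ∀ x ∈ P.termRegion ϑ, α₁ ‖x - P.xr‖ ≤ P.Vf (x - P.xr))
    (hκf : ∀ x ∈ P.termRegion ϑ,
      P.Vf (P.F x (P.κf x) - P.xr) - P.Vf (x - P.xr) ≤ - P.ls (x - P.xr) (P.κf x - P.ur) ∧
      P.κf x ∈ P.U)
    (htϑ : t ≤ ϑ) (htr : t < α₁ r) {x : NState na nb ny nu} (hx : x ∈ P.X)
    (hxt : x ∈ P.termRegion t) :
    P.κf x ∈ P.U ∧ P.F x (P.κf x) ∈ P.X ∧ P.F x (P.κf x) ∈ P.termRegion t ∧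
      P.Vf (P.F x (P.κf x) - P.xr) + P.l x (P.κf x) ≤ P.Vf (x - P.xr) := by
  have hmono : P.termRegion t ⊆ P.termRegion ϑ := fun z hz => le_trans hz htϑ
  obtain ⟨hd, hU⟩ := hκf x (hmono hxt)
  have hdec : P.Vf (P.F x (P.κf x) - P.xr) + P.l x (P.κf x) ≤ P.Vf (x - P.xr) := by
    rw [l_eq_ls hb0 hx]; linarith
  have hFt : P.F x (P.κf x) ∈ P.termRegion t := by
    have := hl0 x hx _ hU
    have hxt' : P.Vf (x - P.xr) ≤ t := hxt
    change P.Vf (P.F x (P.κf x) - P.xr) ≤ t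
    linarith
  -- `t < α₁ r` confines the level set to the ball of radius `r`, where outputs are admissible.
  refine ⟨hU, push_mem_X hY hx hU ?_, hFt, hdec⟩
  refine (hα₁.lt_of_lt (norm_nonneg _) hr ?_).le
  exact ((hlow _ (hmono hFt)).trans hFt).trans_lt htr

/-- The stage costs telescope against `Vf`, and the weight `λ ≥ 1` only helps. -/
lemma termInputs_feasible_cost_le {t : ℝ} (hlam : 1 ≤ P.lam)
    (hl0 : ∀ x ∈ P.X, ∀ u ∈ P.U, 0 ≤ P.l x u)
    (hstep : ∀ x ∈ P.X, x ∈ P.termRegion t →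
      P.κf x ∈ P.U ∧ P.F x (P.κf x) ∈ P.X ∧ P.F x (P.κf x) ∈ P.termRegion t ∧
      P.Vf (P.F x (P.κf x) - P.xr) + P.l x (P.κf x) ≤ P.Vf (x - P.xr))
    {x : NState na nb ny nu} (hx : x ∈ P.X) (hxt : x ∈ P.termRegion t) :
    P.Feasible x (P.termInputs x) ∧ P.cost x (P.termInputs x) ≤ P.lam * P.Vf (x - P.xr) := by
  set g : NState na nb ny nu → NState na nb ny nu := fun z => P.F z (P.κf z) with hg
  have hmem : ∀ j, g^[j] x ∈ P.X ∧ g^[j] x ∈ P.termRegion t := by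
    intro j
    induction j with
    | zero => exact ⟨hx, hxt⟩
    | succ j ih =>
      rw [Function.iterate_succ_apply']
      exact ⟨(hstep _ ih.1 ih.2).2.1, (hstep _ ih.1 ih.2).2.2.1⟩
  have hinput : ∀ j, P.predInput x (P.termInputs x) j = P.κf (g^[j] x) := fun j => by
    rw [predInput, pred_termInputs, ctrl_termInputs]
  have hsum : ∀ N, ∑ i ∈ Finset.range N, P.l (P.pred x (P.termInputs x) i)
      (P.predInput x (P.termInputs x) i) + P.lam * P.Vf (P.pred x (P.termInputs x) N - P.xr) ≤
      P.lam * P.Vf (x - P.xr) := by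
    intro N
    induction N with
    | zero => simp [pred]
    | succ N ih =>
      rw [Finset.sum_range_succ]
      rw [pred_termInputs, ← hg] at ih
      rw [pred_termInputs, pred_termInputs, ← hg, hinput, Function.iterate_succ_apply']
      obtain ⟨h1, -, -, h2⟩ := hstep _ (hmem N).1 (hmem N).2
      have h3 := hl0 _ (hmem N).1 _ h1
      have h4 := mul_le_mul_of_nonneg_left h2 (zero_le_one.trans hlam)
      have h5 := mul_le_mul_of_nonneg_right hlam h3
      change _ + P.lam * P.Vf (P.F (g^[N] x) (P.κf (g^[N] x)) - P.xr) ≤ _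
      linarith
  refine ⟨fun j _ => ⟨?_, ?_⟩, hsum P.Np⟩
  · rw [pred_termInputs]; exact (hmem j).1
  · rw [hinput]; exact (hstep _ (hmem j).1 (hmem j).2).1

/-! ### The optimal cost -/

lemma Feasible.mem_X (hNp : 0 < P.Np) {x : NState na nb ny nu} {v : Fin P.Nc → Inp nu}
    (h : P.Feasible x v) : x ∈ P.X := (h 0 hNp).1

/-- The cost of a feasible decision bounds each of its stage costs and its terminal cost. -/
lemma Feasible.le_cost (hl0 : ∀ x ∈ P.X, ∀ u ∈ P.U, 0 ≤ P.l x u) (hlam : 1 ≤ P.lam)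
    (hVf : ∀ x, 0 ≤ P.Vf (x - P.xr)) {x : NState na nb ny nu} {v : Fin P.Nc → Inp nu}
    (h : P.Feasible x v) :
    (∀ j < P.Np, P.l (P.pred x v j) (P.predInput x v j) ≤ P.cost x v) ∧
      P.Vf (P.pred x v P.Np - P.xr) ≤ P.cost x v := by
  have h1 : ∀ j ∈ Finset.range P.Np, 0 ≤ P.l (P.pred x v j) (P.predInput x v j) := fun j hj =>
    hl0 _ (h j (Finset.mem_range.1 hj)).1 _ (h j (Finset.mem_range.1 hj)).2
  have h2 := hVf (P.pred x v P.Np)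
  have h3 : P.Vf (P.pred x v P.Np - P.xr) ≤ P.lam * P.Vf (P.pred x v P.Np - P.xr) :=
    le_mul_of_one_le_left h2 hlam
  have h4 := Finset.sum_nonneg h1
  refine ⟨fun j hj => ?_, by rw [cost]; linarith⟩
  have := Finset.single_le_sum h1 (Finset.mem_range.2 hj)
  rw [cost]; linarith

lemma optCost_le_cost (hl0 : ∀ x ∈ P.X, ∀ u ∈ P.U, 0 ≤ P.l x u) (hlam : 1 ≤ P.lam)
    (hVf : ∀ x, 0 ≤ P.Vf (x - P.xr)) {x : NState na nb ny nu} {v : Fin P.Nc → Inp nu}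
    (h : P.Feasible x v) : P.optCost x ≤ P.cost x v := by
  refine csInf_le ⟨0, ?_⟩ ⟨v, h, rfl⟩
  rintro _ ⟨w, hw, rfl⟩
  exact (hVf _).trans (hw.le_cost hl0 hlam hVf).2

lemma IsOptimal.optCost_eq {x : NState na nb ny nu} {v : Fin P.Nc → Inp nu}
    (h : P.IsOptimal x v) : P.optCost x = P.cost x v :=
  IsLeast.csInf_eq ⟨⟨v, h.1, rfl⟩, by rintro _ ⟨w, hw, rfl⟩; exact h.2 w hw⟩

/-! ### The shifted decision -/

/-- The decision at the predicted successor that continues the prediction with the terminal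
law. -/
def shift (P : NSVBMPC na nb ny nu M) (x : NState na nb ny nu) (v : Fin P.Nc → Inp nu) :
    Fin P.Nc → Inp nu := fun j => P.predInput x v (j + 1)

/-- The last free input of the shifted decision is the value of `κf` along the old prediction, so
the two predictions agree at every step, even past the horizon. -/
lemma pred_shift (x : NState na nb ny nu) (v : Fin P.Nc → Inp nu) (j : ℕ) :
    P.pred (P.pred x v 1) (P.shift x v) j = P.pred x v (j + 1) ∧
      P.predInput (P.pred x v 1) (P.shift x v) j = P.predInput x v (j + 1) := by
  have hin : ∀ j, P.pred (P.pred x v 1) (P.shift x v) j = P.pred x v (j + 1) →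
      P.predInput (P.pred x v 1) (P.shift x v) j = P.predInput x v (j + 1) := by
    intro j hj
    rcases lt_or_ge j P.Nc with h | h
    · rw [predInput, ctrl_of_lt _ h]; rfl
    · rw [predInput, predInput, ctrl_of_le _ h, ctrl_of_le _ (h.trans j.le_succ), hj]
  have hpred : P.pred (P.pred x v 1) (P.shift x v) j = P.pred x v (j + 1) := by
    induction j with
    | zero => rfl
    | succ j ih =>
      have := hin j ih
      rw [predInput, predInput] at this
      rw [pred, this, ih]
      rfl
  exact ⟨hpred, hin j hpred⟩

/-- One stage leaves at the front and one enters at the end. The last two terms have nonpositive sum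
once `Vf` decreases by the nonnegative stage cost, because `λ ≥ 1`. -/
lemma cost_shift (hNp : P.Nc ≤ P.Np) (x : NState na nb ny nu) (v : Fin P.Nc → Inp nu) :
    P.cost (P.pred x v 1) (P.shift x v) = P.cost x v - P.l x (P.predInput x v 0)
      + P.l (P.pred x v P.Np) (P.κf (P.pred x v P.Np))
      + P.lam * (P.Vf (P.F (P.pred x v P.Np) (P.κf (P.pred x v P.Np)) - P.xr)
        - P.Vf (P.pred x v P.Np - P.xr)) := by
  have h1 := Finset.sum_range_succ (fun i => P.l (P.pred x v i) (P.predInput x v i)) P.Np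
  rw [Finset.sum_range_succ'] at h1
  have h2 : P.predInput x v P.Np = P.κf (P.pred x v P.Np) := by rw [predInput, ctrl_of_le _ hNp]
  have h3 : P.pred x v (P.Np + 1) = P.F (P.pred x v P.Np) (P.κf (P.pred x v P.Np)) := by
    rw [pred, ctrl_of_le _ hNp]
  rw [cost, cost]
  simp only [pred_shift]
  rw [h3]
  rw [h2, show P.pred x v 0 = x from rfl] at h1
  linarith

/-! ### Predictions from perturbed initial states -/

/-- The prediction satisfies the constraints, up to its end, and stays within `r` of the
reference. -/
def StaysNear (P : NSVBMPC na nb ny nu M) (r : ℝ) (w : NState na nb ny nu)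
    (v : Fin P.Nc → Inp nu) : Prop :=
  (∀ j ≤ P.Np, P.pred w v j ∈ P.X ∧ ‖P.pred w v j - P.xr‖ ≤ r) ∧
    ∀ j < P.Np, P.predInput w v j ∈ P.U

/-- A free input is the same at both states, so uniformity in `u` suffices. Under `κf` the inputs
differ, and continuity of the composition is needed. -/
lemma unifCont_ctrl {H : Type*} [PseudoMetricSpace H] {g : NState na nb ny nu → Inp nu → H}
    {S T : Set (NState na nb ny nu)} (hg : UnifContInState g S P.U)
    (htail : P.Nc < P.Np → UniformContinuousOn (fun x => g x (P.κf x)) (S ∩ T))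
    {j : ℕ} (hj : j < P.Np) {ε : ℝ} (hε : 0 < ε) :
    ∃ η > 0, ∀ x ∈ S ∩ T, ∀ x' ∈ S ∩ T, ∀ v : Fin P.Nc → Inp nu, P.ctrl v j x ∈ P.U →
      dist x x' < η → dist (g x (P.ctrl v j x)) (g x' (P.ctrl v j x')) < ε := by
  rcases lt_or_ge j P.Nc with h | h
  · obtain ⟨η, hη, hd⟩ := hg ε hε
    refine ⟨η, hη, fun x hx x' hx' v hv hdist => ?_⟩
    rw [ctrl_of_lt _ h] at hv ⊢
    rw [ctrl_of_lt _ h]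
    exact hd x hx.1 x' hx'.1 hdist _ hv
  · obtain ⟨η, hη, hd⟩ := Metric.uniformContinuousOn_iff.1 (htail (h.trans_lt hj)) ε hε
    refine ⟨η, hη, fun x hx x' hx' v _ hdist => ?_⟩
    rw [ctrl_of_le _ h, ctrl_of_le _ h]
    exact hd x hx x' hx' hdist

/-- Predictions depend uniformly continuously on the initial state. -/
lemma exists_pred_close {S T : Set (NState na nb ny nu)} {r : ℝ} (hr : 0 < r)
    (hY : Metric.closedBall P.yr (r + r) ⊆ P.Y)
    (hnear : ∀ x ∈ P.X, ‖x - P.xr‖ ≤ r + r → x ∈ S ∩ T) (hκf : ∀ x ∈ T, P.κf x ∈ P.U)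
    (hF : UnifContInState P.F S P.U)
    (hFtail : P.Nc < P.Np → UniformContinuousOn (fun x => P.F x (P.κf x)) (S ∩ T))
    {j : ℕ} (hj : j ≤ P.Np) {ε : ℝ} (hε : 0 < ε) :
    ∃ η > 0, ∀ w z v, P.StaysNear r w v → z ∈ P.X → dist z w < η →
      P.pred z v j ∈ P.X ∧ P.pred z v j ∈ S ∩ T ∧ dist (P.pred z v j) (P.pred w v j) < ε ∧
        (j < P.Np → P.predInput z v j ∈ P.U) := by
  -- The nominal prediction stays within `r` of `xr` and the perturbed one within `r` of it; hence
  -- the radius `r + r`.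
  have hclose : ∀ {x y : NState na nb ny nu}, ‖y - P.xr‖ ≤ r → dist x y ≤ r →
      ‖x - P.xr‖ ≤ r + r := by
    intro x y hy hxy
    rw [← dist_eq_norm] at hy ⊢
    linarith [dist_triangle x y P.xr]
  have hrest : ∀ {w z v j}, j ≤ P.Np → P.StaysNear r w v → P.pred z v j ∈ P.X →
      dist (P.pred z v j) (P.pred w v j) ≤ r →
      P.pred z v j ∈ S ∩ T ∧ (j < P.Np → P.predInput z v j ∈ P.U) := by
    intro w z v j hj hw hz hd
    have hST := hnear _ hz (hclose (hw.1 j hj).2 hd)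
    refine ⟨hST, fun hjN => ?_⟩
    rcases lt_or_ge j P.Nc with h | h
    · have := hw.2 j hjN
      rw [predInput, ctrl_of_lt _ h] at this ⊢
      exact this
    · rw [predInput, ctrl_of_le _ h]
      exact hκf _ hST.2
  induction j generalizing ε with
  | zero =>
    refine ⟨min ε r, lt_min hε hr, fun w z v hw hz hd => ?_⟩
    have := hrest (z := z) hj hw hz (hd.le.trans (min_le_right _ _))
    exact ⟨hz, this.1, hd.trans_le (min_le_left _ _), this.2⟩
  | succ j ih =>
    -- The tolerance is capped by `r` so that the next state remains where `hnear` applies.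
    obtain ⟨η₁, hη₁, h₁⟩ := unifCont_ctrl hF hFtail (Nat.lt_of_succ_le hj) (lt_min hε hr)
    obtain ⟨η, hη, h₂⟩ := ih (Nat.le_of_succ_le hj) hη₁
    refine ⟨η, hη, fun w z v hw hz hd => ?_⟩
    obtain ⟨hzX, hzS, hzd, hzU⟩ := h₂ w z v hw hz hd
    have hwj := hw.1 j (Nat.le_of_succ_le hj)
    have hd' := h₁ _ hzS _ (hnear _ hwj.1 (hwj.2.trans (by linarith))) v
      (hzU (Nat.lt_of_succ_le hj)) hzd
    have hdε : dist (P.pred z v (j + 1)) (P.pred w v (j + 1)) < ε :=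
      hd'.trans_le (min_le_left _ _)
    have hdr : dist (P.pred z v (j + 1)) (P.pred w v (j + 1)) ≤ r :=
      hd'.le.trans (min_le_right _ _)
    have hX : P.pred z v (j + 1) ∈ P.X :=
      push_mem_X hY hzX (hzU (Nat.lt_of_succ_le hj)) (hclose (hw.1 _ hj).2 hdr)
    have := hrest hj hw hX hdr
    exact ⟨hX, this.1, hdε, this.2⟩

/-- Decisions remain feasible under small perturbations of the initial state, and their cost
increases by little. -/
lemma exists_cost_close {S T : Set (NState na nb ny nu)} {r : ℝ} (hr : 0 < r)
    (hlam : 0 < P.lam)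
    (hY : Metric.closedBall P.yr (r + r) ⊆ P.Y)
    (hnear : ∀ x ∈ P.X, ‖x - P.xr‖ ≤ r + r → x ∈ S ∩ T) (hκf : ∀ x ∈ T, P.κf x ∈ P.U)
    (hF : UnifContInState P.F S P.U)
    (hFtail : P.Nc < P.Np → UniformContinuousOn (fun x => P.F x (P.κf x)) (S ∩ T))
    (hl : UnifContInState P.l S P.U)
    (hltail : P.Nc < P.Np → UniformContinuousOn (fun x => P.l x (P.κf x)) (S ∩ T))
    (hV : UniformContinuousOn (fun x => P.Vf (x - P.xr)) S) {ε : ℝ} (hε : 0 < ε) :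
    ∃ η > 0, ∀ w z v, P.StaysNear r w v → z ∈ P.X → dist z w < η →
      P.Feasible z v ∧ P.cost z v ≤ P.cost w v + ε := by
  have hwS : ∀ {w v j}, P.StaysNear r w v → j ≤ P.Np → P.pred w v j ∈ S ∩ T := fun hw hj =>
    hnear _ (hw.1 _ hj).1 ((hw.1 _ hj).2.trans (by linarith))
  have hsum : ∀ N ≤ P.Np, ∀ ε > 0, ∃ η > 0, ∀ w z v, P.StaysNear r w v → z ∈ P.X →
      dist z w < η → (∀ j < N, P.pred z v j ∈ P.X ∧ P.predInput z v j ∈ P.U) ∧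
        ∑ i ∈ Finset.range N, P.l (P.pred z v i) (P.predInput z v i) ≤
          ∑ i ∈ Finset.range N, P.l (P.pred w v i) (P.predInput w v i) + ε := by
    intro N
    induction N with
    | zero => exact fun _ ε hε => ⟨1, one_pos, fun w z v _ _ _ => by simpa using hε.le⟩
    | succ N ih =>
      intro hN ε hε
      obtain ⟨η₁, hη₁, h₁⟩ := ih (Nat.le_of_succ_le hN) (ε / 2) (half_pos hε)
      obtain ⟨η₂, hη₂, h₂⟩ := unifCont_ctrl hl hltail (Nat.lt_of_succ_le hN) (half_pos hε)
      obtain ⟨η₃, hη₃, h₃⟩ := exists_pred_close hr hY hnear hκf hF hFtail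
        (Nat.le_of_succ_le hN) hη₂
      refine ⟨min η₁ η₃, lt_min hη₁ hη₃, fun w z v hw hz hd => ?_⟩
      obtain ⟨hfeas, hle⟩ := h₁ w z v hw hz (hd.trans_le (min_le_left _ _))
      obtain ⟨hzX, hzS, hzd, hzU⟩ := h₃ w z v hw hz (hd.trans_le (min_le_right _ _))
      have hU := hzU (Nat.lt_of_succ_le hN)
      refine ⟨fun j hj => ?_, ?_⟩
      · rcases (Nat.lt_succ_iff.1 hj).eq_or_lt with rfl | hj
        · exact ⟨hzX, hU⟩
        · exact hfeas j hj
      · rw [Finset.sum_range_succ, Finset.sum_range_succ]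
        have := h₂ _ hzS _ (hwS hw (Nat.le_of_succ_le hN)) v hU hzd
        rw [Real.dist_eq] at this
        have := (abs_lt.1 this).2
        simp only [predInput] at hle ⊢
        linarith
  obtain ⟨η₁, hη₁, h₁⟩ := hsum P.Np le_rfl (ε / 2) (half_pos hε)
  obtain ⟨η₂, hη₂, h₂⟩ := Metric.uniformContinuousOn_iff.1 hV (ε / (2 * P.lam)) (by positivity)
  obtain ⟨η₃, hη₃, h₃⟩ := exists_pred_close hr hY hnear hκf hF hFtail le_rfl hη₂
  refine ⟨min η₁ η₃, lt_min hη₁ hη₃, fun w z v hw hz hd => ?_⟩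
  obtain ⟨hfeas, hle⟩ := h₁ w z v hw hz (hd.trans_le (min_le_left _ _))
  obtain ⟨-, hzS, hzd, -⟩ := h₃ w z v hw hz (hd.trans_le (min_le_right _ _))
  refine ⟨hfeas, ?_⟩
  have h4 := h₂ _ hzS.1 _ (hwS hw le_rfl).1 hzd
  rw [Real.dist_eq] at h4
  have h5 := mul_lt_mul_of_pos_left (abs_lt.1 h4).2 hlam
  rw [show P.lam * (ε / (2 * P.lam)) = ε / 2 by field_simp] at h5
  rw [cost, cost]
  linarith

end NSVBMPC

end

/-! ### The main theorem. -/

theorem theorem4 {na nb ny nu M : ℕ} (P : NSVBMPC na nb ny nu M)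
    -- horizons and terminal weight
    (hNc : 1 ≤ P.Nc) (hNp : P.Nc ≤ P.Np) (hlam : 1 ≤ P.lam)
    -- the reference is an admissible equilibrium
    (hyr : P.yr ∈ interior P.Y) (hur : P.ur ∈ P.U) (heq : P.F P.xr P.ur = P.xr)
    -- the barrier cost
    (hb0 : ∀ y ∈ P.Y, P.lb y = 0)
    (hb : ∃ αb, IsClassK αb ∧ ∀ y, αb (Metric.infDist y P.Y) ≤ P.lb y)
    -- the stage cost
    (hlcont : Continuous (fun p : NState na nb ny nu × Inp nu => P.l p.1 p.2))
    (hl : ∃ αx αu, IsClassK αx ∧ IsClassK αu ∧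
      ∀ x ∈ P.X, ∀ u ∈ P.U, αx ‖x - P.xr‖ + αu ‖u - P.ur‖ ≤ P.l x u)
    (hl0 : P.l P.xr P.ur = 0)
    (hly : ∃ αy, IsClassK αy ∧ ∀ x ∈ P.X, ∀ u ∈ P.U, αy ‖x - P.xr‖ ≤ P.l x u)
    -- the terminal ingredients, and a lower bound of the stage cost outside the terminal region
    (ϑ : ℝ) (hϑ : 0 < ϑ) (hterm : P.TerminalIngredients ϑ)
    (d : ℝ) (hd : 0 < d) (hdl : ∀ x ∈ P.X, x ∉ P.termRegion ϑ → ∀ u ∈ P.U, d ≤ P.l x u)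
    -- uniform continuity of the model, the stage cost and the terminal cost
    (hFu : UnifContInState P.F (P.region ϑ d) P.U)
    (hlu : UnifContInState P.l (P.region ϑ d) P.U)
    (hVu : UniformContinuousOn (fun x => P.Vf (x - P.xr)) (P.region ϑ d))
    -- the same along the terminal law, which enters the problem only if `N_c < N_p`
    (htail : P.Nc < P.Np →
      UniformContinuousOn (fun x => P.F x (P.κf x)) (P.region ϑ d ∩ P.termRegion ϑ) ∧
      UniformContinuousOn (fun x => P.l x (P.κf x)) (P.region ϑ d ∩ P.termRegion ϑ))
    -- the predictive controller
    (κ : NState na nb ny nu → Inp nu) (hκ : P.IsPredictiveController κ (P.region ϑ d)) :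
    ∃ νbar : ℝ, 0 < νbar ∧ ∀ ν : ℝ, 0 ≤ ν → ν ≤ νbar →
      ∃ Ω : Set (NState na nb ny nu), Ω ⊆ P.region ϑ d ∧ Ω ∈ 𝓝[P.X] P.xr ∧
        P.RobustInvariant κ ν Ω ∧ P.ISSOn κ ν Ω := by
  have hNp0 : 0 < P.Np := hNc.trans hNp
  have hlam0 : 0 < P.lam := one_pos.trans_le hlam
  obtain ⟨αx, αu, hαx, hαu, hαl⟩ := hl
  obtain ⟨hint, ⟨α₁, α₂, ⟨hα₁, -⟩, ⟨hα₂, -⟩, hVα⟩, hκf⟩ := hterm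
  have hαxl : ∀ x ∈ P.X, ∀ u ∈ P.U, αx ‖x - P.xr‖ ≤ P.l x u := fun x hx u hu =>
    (le_add_of_nonneg_right (hαu.nonneg (norm_nonneg _))).trans (hαl x hx u hu)
  have hl_nonneg : ∀ x ∈ P.X, ∀ u ∈ P.U, 0 ≤ P.l x u := fun x hx u hu =>
    (hαx.nonneg (norm_nonneg _)).trans (hαxl x hx u hu)
  have hVf : ∀ x, 0 ≤ P.Vf (x - P.xr) :=
    NSVBMPC.termRegion_Vf_nonneg hϑ hα₁ fun x hx => (hVα x hx).1
  have hbound : 0 < P.Np * d + P.lam * ϑ := by positivity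
  -- a radius on which outputs are admissible and states are in the terminal region
  obtain ⟨r₀, hr₀, hY, hT⟩ : ∃ r₀ > 0, Metric.closedBall P.yr r₀ ⊆ P.Y ∧
      Metric.closedBall P.xr r₀ ⊆ P.termRegion ϑ := by
    obtain ⟨a, ha, hYa⟩ := Metric.nhds_basis_closedBall.mem_iff.1 (mem_interior_iff_mem_nhds.1 hyr)
    obtain ⟨b, hb, hTb⟩ := Metric.nhds_basis_closedBall.mem_iff.1 (mem_interior_iff_mem_nhds.1 hint)
    exact ⟨min a b, lt_min ha hb,
      (Metric.closedBall_subset_closedBall (min_le_left _ _)).trans hYa,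
      (Metric.closedBall_subset_closedBall (min_le_right _ _)).trans hTb⟩
  -- a level of the terminal cost that is invariant under the terminal law
  obtain ⟨t, ht, htϑ, htr⟩ : ∃ t, 0 < t ∧ t ≤ ϑ ∧ t < α₁ r₀ :=
    ⟨min ϑ (α₁ r₀ / 2), lt_min hϑ (half_pos (hα₁.pos hr₀)), min_le_left _ _,
      (min_le_right _ _).trans_lt (half_lt_self (hα₁.pos hr₀))⟩
  have hstep := fun x hx hxt => NSVBMPC.term_step hY hr₀.le hb0 hl_nonneg hα₁
    (fun x hx => (hVα x hx).1) hκf htϑ htr (x := x) hx hxt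
  -- a radius on which the terminal law gives an upper bound of the optimal cost
  obtain ⟨r, hr, hrr₀, hrt, hrb⟩ : ∃ r > 0, r + r ≤ r₀ ∧ α₂ (r + r) ≤ t ∧
      P.lam * α₂ (r + r) ≤ P.Np * d + P.lam * ϑ := by
    obtain ⟨s, hs, hst⟩ := hα₂.exists_pos_lt (ε := min t ((P.Np * d + P.lam * ϑ) / P.lam))
      (lt_min ht (div_pos hbound hlam0))
    have hrs : min s r₀ / 2 + min s r₀ / 2 = min s r₀ := add_halves _
    refine ⟨min s r₀ / 2, half_pos (lt_min hs hr₀), ?_⟩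
    rw [hrs]
    have hle := (hα₂.mono (lt_min hs hr₀).le (min_le_left s r₀)).trans hst.le
    refine ⟨min_le_right _ _, hle.trans (min_le_left _ _), ?_⟩
    rw [mul_comm, ← le_div_iff₀ hlam0]
    exact hle.trans (min_le_right _ _)
  have hupp : ∀ x ∈ P.X, ‖x - P.xr‖ ≤ r + r → (∃ v, P.Feasible x v) ∧ x ∈ P.termRegion ϑ ∧
      P.optCost x ≤ P.lam * α₂ ‖x - P.xr‖ := by
    intro x hx hxr
    have hxT : x ∈ P.termRegion ϑ := hT (mem_closedBall_iff_norm.2 (hxr.trans hrr₀))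
    have hxV := (hVα x hxT).2
    have hxt : x ∈ P.termRegion t := (hxV.trans (hα₂.mono (norm_nonneg _) hxr)).trans hrt
    obtain ⟨hfeas, hcost⟩ := NSVBMPC.termInputs_feasible_cost_le hlam hl_nonneg hstep hx hxt
    exact ⟨⟨_, hfeas⟩, hxT, (NSVBMPC.optCost_le_cost hl_nonneg hlam hVf hfeas).trans
      (hcost.trans (mul_le_mul_of_nonneg_left hxV hlam0.le))⟩
  have hnear : ∀ x ∈ P.X, ‖x - P.xr‖ ≤ r + r → x ∈ P.region ϑ d ∩ P.termRegion ϑ := by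
    intro x hx hxr
    obtain ⟨h1, h2, h3⟩ := hupp x hx hxr
    exact ⟨⟨h1, h3.trans ((mul_le_mul_of_nonneg_left (hα₂.mono (norm_nonneg _) hxr)
      hlam0.le).trans hrb)⟩, h2⟩
  -- the level of the optimal cost
  obtain ⟨c, hc, hcx, hc₁, hct, hcb⟩ : ∃ c, 0 < c ∧ c < αx r ∧ c < α₁ r ∧ c ≤ t ∧
      c ≤ P.Np * d + P.lam * ϑ := by
    have h1 := hαx.pos hr
    have h2 := hα₁.pos hr
    -- The bounds keep in turn the stage states within `r`, the end state within `r`, the end state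
    -- in the invariant level, and the sublevel set inside the region.
    have hm : 0 < min (min (αx r) (α₁ r)) (min t (P.Np * d + P.lam * ϑ)) :=
      lt_min (lt_min h1 h2) (lt_min ht hbound)
    have hm' := half_lt_self hm
    exact ⟨_, half_pos hm, hm'.trans_le ((min_le_left _ _).trans (min_le_left _ _)),
      hm'.trans_le ((min_le_left _ _).trans (min_le_right _ _)),
      hm'.le.trans ((min_le_right _ _).trans (min_le_left _ _)),
      hm'.le.trans ((min_le_right _ _).trans (min_le_right _ _))⟩
  set Ω : Set (NState na nb ny nu) := {x | x ∈ P.region ϑ d ∧ P.optCost x ≤ c} with hΩ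
  -- the nominal prediction and its shift
  have hnom : ∀ x ∈ Ω, x ∈ P.X ∧ κ x ∈ P.U ∧ αx ‖x - P.xr‖ ≤ P.optCost x ∧ ‖x - P.xr‖ ≤ r ∧
      ∃ v, P.StaysNear r (P.F x (κ x)) v ∧
        P.cost (P.F x (κ x)) v ≤ P.optCost x - αx ‖x - P.xr‖ := by
    rintro x ⟨hxR, hxc⟩
    obtain ⟨v, hv, hκx⟩ := hκ x hxR
    have hF1 : P.F x (κ x) = P.pred x v 1 := by rw [hκx]; rfl
    obtain ⟨hstage, hend⟩ := hv.1.le_cost hl_nonneg hlam hVf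
    rw [← hv.optCost_eq] at hstage hend
    have hxX := hv.1.mem_X hNp0
    have hκU : κ x ∈ P.U := hκx ▸ (hv.1 0 hNp0).2
    have hpred : ∀ j < P.Np, αx ‖P.pred x v j - P.xr‖ ≤ P.optCost x := fun j hj =>
      (hαxl _ (hv.1 j hj).1 _ (hv.1 j hj).2).trans (hstage j hj)
    have hpredr : ∀ j < P.Np, ‖P.pred x v j - P.xr‖ ≤ r := fun j hj =>
      (hαx.lt_of_lt (norm_nonneg _) hr.le (((hpred j hj).trans hxc).trans_lt hcx)).le
    have hVr : ∀ z, P.Vf (z - P.xr) ≤ c → ‖z - P.xr‖ ≤ r := fun z hz =>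
      (hα₁.lt_of_lt (norm_nonneg _) hr.le
        (((hVα z (hz.trans (hct.trans htϑ))).1.trans hz).trans_lt hc₁)).le
    have hendc := hend.trans hxc
    have hendr := hVr _ hendc
    -- The problem leaves the state at `P.Np` unconstrained. It is admissible as a successor of an
    -- admissible state that lies near the reference.
    have hendX : P.pred x v P.Np ∈ P.X := by
      obtain ⟨N, hN⟩ := Nat.exists_eq_succ_of_ne_zero hNp0.ne'
      have h := hv.1 N (by omega)
      rw [hN] at hendr ⊢
      exact NSVBMPC.push_mem_X hY h.1 h.2 (hendr.trans (by linarith))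
    -- `c ≤ t` acts as an implicit terminal constraint.
    obtain ⟨hκfU, hnextX, -, hdec⟩ := hstep _ hendX (hendc.trans hct)
    have hnext : P.pred x v (P.Np + 1) =
        P.F (P.pred x v P.Np) (P.κf (P.pred x v P.Np)) := by
      rw [NSVBMPC.pred, NSVBMPC.ctrl_of_le _ hNp]
    have hnextr : ‖P.pred x v (P.Np + 1) - P.xr‖ ≤ r := by
      rw [hnext]
      have := hl_nonneg _ hendX _ hκfU
      exact hVr _ (by linarith)
    refine ⟨hxX, hκU, hpred 0 hNp0, hpredr 0 hNp0, P.shift x v, ⟨fun j hj => ?_, fun j hj => ?_⟩, ?_⟩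
    · rw [hF1, (NSVBMPC.pred_shift x v j).1]
      -- After the shift, index `P.Np` is the appended state and `P.Np - 1` the old end state;
      -- earlier ones are constrained by feasibility.
      rcases hj.eq_or_lt with rfl | hj
      · exact ⟨hnext ▸ hnextX, hnextr⟩
      · rcases (Nat.succ_le_of_lt hj).eq_or_lt with h | h
        · rw [← Nat.succ_eq_add_one, h]
          exact ⟨hendX, hendr⟩
        · exact ⟨(hv.1 _ h).1, hpredr _ h⟩
    · rw [hF1, (NSVBMPC.pred_shift x v j).2]
      rcases (Nat.succ_le_of_lt hj).eq_or_lt with h | h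
      · rw [← Nat.succ_eq_add_one, h, NSVBMPC.predInput, NSVBMPC.ctrl_of_le _ hNp]
        exact hκfU
      · exact (hv.1 _ h).2
    · rw [hF1, NSVBMPC.cost_shift hNp, ← hv.optCost_eq]
      have h1 := hαxl x hxX _ (hv.1 0 hNp0).2
      have h2 := hl_nonneg _ hendX _ hκfU
      nlinarith
  -- the decrease of the optimal cost along the closed loop
  have hdecr : ∀ ε > 0, ∃ η > 0, ∀ x ∈ Ω, ∀ δ : Out ny, ‖δ‖ < η →
      (∃ v, P.Feasible (P.trueStep κ x δ) v) ∧
        P.optCost (P.trueStep κ x δ) ≤ P.optCost x - αx ‖x - P.xr‖ + ε := by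
    intro ε hε
    obtain ⟨η, hη, hclose⟩ := NSVBMPC.exists_cost_close hr hlam0
      ((Metric.closedBall_subset_closedBall hrr₀).trans hY) hnear (fun x hx => (hκf x hx).2) hFu
      (fun h => (htail h).1) hlu (fun h => (htail h).2) hVu hε
    -- The bound `r` puts the true successor within `r + r ≤ r₀` of the reference, hence in `P.X`.
    refine ⟨min η r, lt_min hη hr, fun x hx δ hδ => ?_⟩
    obtain ⟨hxX, hκU, -, -, v, hv, hcost⟩ := hnom x hx
    have hdist : dist (P.trueStep κ x δ) (P.F x (κ x)) = ‖δ‖ := by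
      rw [dist_eq_norm]; exact NState.norm_push_add_sub_push _ _ _ _
    have hX : P.trueStep κ x δ ∈ P.X := by
      refine NSVBMPC.push_mem_X hY hxX hκU ?_
      have h1 := (hv.1 0 (Nat.zero_le _)).2
      have h2 := hdist.trans_lt hδ
      have h3 := min_le_right η r
      have h4 := dist_triangle (P.trueStep κ x δ) (P.F x (κ x)) P.xr
      rw [dist_eq_norm, dist_eq_norm _ P.xr] at h4
      rw [dist_eq_norm] at h2
      change ‖P.F x (κ x) - P.xr‖ ≤ r at h1
      change ‖P.trueStep κ x δ - P.xr‖ ≤ r₀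
      linarith
    obtain ⟨hfeas, hle⟩ := hclose _ _ v hv hX (hdist.trans_lt (hδ.trans_le (min_le_left _ _)))
    exact ⟨⟨v, hfeas⟩, (NSVBMPC.optCost_le_cost hl_nonneg hlam hVf hfeas).trans (by linarith)⟩
  have hxrX : P.xr ∈ P.X := NSVBMPC.xr_mem_X (interior_subset hyr) hur
  have hα₂' : IsClassK (fun s => P.lam * α₂ s) := hα₂.const_mul hlam0
  have hΩupp : ∀ x ∈ Ω, P.optCost x ≤ P.lam * α₂ ‖x - P.xr‖ := fun x hx =>
    (hupp x (hnom x hx).1 ((hnom x hx).2.2.2.1.trans (by linarith))).2.2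
  -- the admissible size of the prediction error
  obtain ⟨s, hs, hsc⟩ := hα₂'.exists_pos_lt (half_pos hc)
  -- If the optimal cost is at most `c / 2`, an error of `c / 2` keeps it below `c`. Otherwise `‖x -
  -- xr‖ > s`, and the decrease `αx s` absorbs the error.
  obtain ⟨η, hη, hinv⟩ := hdecr (min (c / 2) (αx s)) (lt_min (half_pos hc) (hαx.pos hs))
  have hinvΩ : ∀ x ∈ Ω, ∀ δ : Out ny, ‖δ‖ < η → P.trueStep κ x δ ∈ Ω := by
    intro x hx δ hδ
    obtain ⟨hfeas, hle⟩ := hinv x hx δ hδ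
    have hlec : P.optCost (P.trueStep κ x δ) ≤ c := by
      rcases le_total (P.optCost x) (c / 2) with h | h
      · have := hαx.nonneg (norm_nonneg (x - P.xr))
        linarith [min_le_left (c / 2) (αx s)]
      · have h1 : s < ‖x - P.xr‖ := hα₂'.lt_of_lt hs.le (norm_nonneg _)
          (hsc.trans_le (h.trans (hΩupp x hx)))
        have h2 := hαx.mono hs.le h1.le
        linarith [min_le_right (c / 2) (αx s), hx.2]
    exact ⟨⟨hfeas, hlec.trans hcb⟩, hlec⟩
  -- a relative neighbourhood of the reference
  obtain ⟨q, hq, hqc⟩ := hα₂'.exists_pos_lt hc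
  have hΩmem : ∀ x ∈ P.X, ‖x - P.xr‖ ≤ min q r → x ∈ Ω := by
    intro x hx hxq
    have hxr : ‖x - P.xr‖ ≤ r + r := hxq.trans ((min_le_right _ _).trans (by linarith))
    exact ⟨(hnear x hx hxr).1, (hupp x hx hxr).2.2.trans
      ((hα₂'.mono (norm_nonneg _) (hxq.trans (min_le_left _ _))).trans hqc.le)⟩
  -- One `Ω` serves every `ν`; halving passes from the strict bound on `‖δ‖` to a closed one.
  refine ⟨η / 2, half_pos hη, fun ν _ hν => ⟨Ω, fun x hx => hx.1, ?_, fun x hx δ hδ => ?_, ?_⟩⟩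
  · rw [mem_nhdsWithin_iff_exists_mem_nhds_inter]
    refine ⟨Metric.closedBall P.xr (min q r), Metric.closedBall_mem_nhds _ (lt_min hq hr), ?_⟩
    rintro x ⟨hx, hxX⟩
    exact hΩmem x hxX (mem_closedBall_iff_norm.1 hx)
  · exact hinvΩ x hx δ (by linarith)
  · refine exists_iss_gains (n := fun x => ‖x - P.xr‖) (V := P.optCost) (z := P.xr) (r := r)
      (step := P.trueStep κ) hαx hα₂' (fun x => norm_nonneg _)
      (hΩmem _ hxrX (by simpa using (lt_min hq hr).le)) (by simp) (fun x hx => (hnom x hx).2.2.2.1)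
      (fun x hx => (hnom x hx).2.2.1) hΩupp (fun x hx δ hδ => hinvΩ x hx δ (by linarith)) ?_
    intro ε hε
    obtain ⟨η', hη', h⟩ := hdecr ε hε
    exact ⟨η' / 2, half_pos hη', fun x hx δ _ hδ => (h x hx δ (by linarith)).2⟩
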